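/- For integers $p,n\ge 1$, $\theta>0$ and a Euclidean unit vector $v\in\mathbf{R}^p$, let $\mathbf{P}_0^{n}$ and $\mathbf{P}_v^{n}$ denote the laws of $n$ i.i.d. observations in $\mathbf{R}^p$ with distribution $\mathcal{N}(0,I_p)$ and $\mathcal{N}(0,I_p+\theta vv^\top)$ respectively. For $q\in(0,2)$ and $R>0$ let $|v|_q=\big(\sum_{j=1}^p|v_j|^q\big)^{1/q}$ and $$\mathcal{B}_q(R)=\{v\in\mathbf{R}^p : |v|_2=1,\ |v|_q\le R\}.$$ **Theorem.** Fix $\nu>0$. There exists a constant $C_\nu>0$, depending only on $\nu$, such that for all integers $n\ge 1$ and $1\le k\le p$, all $\theta>0$ with $$\theta<\underline{\theta}_\nu:=\sqrt{\frac{k\log\left(C_\nu p/k^2+1\right)}{n}}\wedge\frac1{\sqrt2},$$ and all $q\in(0,2)$, $$\inf_\psi\Big\{\mathbf{P}_0^{n}(\psi=1)\vee\sup_{v\in\mathcal{B}_q(k^{1/q-1/2})}\mathbf{P}_v^{n}(\psi=0)\Big\}\ge\frac12-\nu,$$ where the infimum is over all tests, i.e. all measurable functions $\psi$ of the $n$ observations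 with values in $\{0,1\}$. -/

import Mathlib

open MeasureTheory ProbabilityTheory
open scoped ENNReal

namespace SparsePCA

/-- The `ℓ_q` "norm" `|v|_q = (∑ j, |v_j| ^ q) ^ (1 / q)`, for a real exponent `q > 0`. -/
noncomputable def lqNorm {p : ℕ} (q : ℝ) (v : EuclideanSpace ℝ (Fin p)) : ℝ :=
  (∑ j, |v j| ^ q) ^ (1 / q)

/-- The set `B_q(R)` of (Euclidean) unit vectors of `ℝ^p` lying in the `ℓ_q` ball of radius `R`,
for `q > 0`. -/
def unitLqBall (p : ℕ) (q R : ℝ) : Set (EuclideanSpace ℝ (Fin p)) :=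
  {v | ‖v‖ = 1 ∧ lqNorm q v ≤ R}

/-- The law `P_0^n` of `n` i.i.d. observations from `N(0, I_p)`. -/
noncomputable def nullLaw (p n : ℕ) : Measure (Fin n → EuclideanSpace ℝ (Fin p)) :=
  Measure.pi fun _ => multivariateGaussian 0 1

/-- The law `P_v^n` of `n` i.i.d. observations from `N(0, I_p + θ v vᵀ)`. -/
noncomputable def spikedLaw (p n : ℕ) (θ : ℝ) (v : EuclideanSpace ℝ (Fin p)) :
    Measure (Fin n → EuclideanSpace ℝ (Fin p)) :=
  Measure.pi fun _ => multivariateGaussian 0 (1 + θ • Matrix.vecMulVec v v)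

/-- A test based on `n` observations in `ℝ^p`: a measurable function of the observations with
values in `{0, 1}`. -/
def Test (p n : ℕ) : Type :=
  {ψ : (Fin n → EuclideanSpace ℝ (Fin p)) → Fin 2 // Measurable ψ}

/-- The worst-case error `P_0^n(ψ = 1) ∨ sup_{v ∈ V} P_v^n(ψ = 0)` of a test `ψ` of the null
hypothesis against the spiked alternatives with spike direction in `V`. -/
noncomputable def worstCaseError {p n : ℕ} (θ : ℝ) (V : Set (EuclideanSpace ℝ (Fin p)))
    (ψ : Test p n) : ℝ≥0∞ :=
  max (nullLaw p n {x | ψ.1 x = 1}) (⨆ v ∈ V, spikedLaw p n θ v {x | ψ.1 x = 0})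

/-- The minimax error: the infimum over all tests of the worst-case error. -/
noncomputable def minimaxError (p n : ℕ) (θ : ℝ) (V : Set (EuclideanSpace ℝ (Fin p))) : ℝ≥0∞ :=
  ⨅ ψ : Test p n, worstCaseError θ V ψ

/-- The detection level `√(k log(C p / k² + 1) / n) ∧ 1 / √2`. -/
noncomputable def detectionLevel (C : ℝ) (p n k : ℕ) : ℝ :=
  min (√((k : ℝ) * Real.log (C * p / (k : ℝ) ^ 2 + 1) / n)) (1 / √2)

end SparsePCA

/-!
The proof is Le Cam's second moment method. Against a finite prior on spike directions `v a` in the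
alternative, every test has worst-case error at least `(1 - δ) / 2` once the averaged likelihood
ratio `L` has `E₀ L² ≤ 1 + δ²` (`le_minimaxError_of_secondMoment`), because then
`E₀ [L; A] ≤ P₀ A + δ` for every event `A` (`setLIntegral_le_measure_add`).

*Likelihood ratios.* An observation from `N(0, I + θ v vᵀ)` has the law of `x + √θ z v` with `x`
standard Gaussian in `ℝ^p` and `z` an independent standard normal. Conditionally on `z` this is a
shift of a standard Gaussian, so the Cameron–Martin formula (`stdGaussian_map_add`) writes the
likelihood ratio as a mixture of exponentials over `z`, without any computation of determinants or
inverse matrices. By Tonelli, the cross moment of the ratios for `u` and `v` is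
`E exp (ρ z z') = (1 - ρ²)^{-1/2}` with `ρ = θ ⟪u, v⟫` (`lintegral_spikedDensity_mul`). As
`θ² ≤ 1/2` this is at most `exp ρ²`, hence at most `exp (n ρ²)` for `n` observations. All these
integrals are lower Lebesgue integrals of nonnegative functions, so that no integrability has to be
verified.

*Prior.* Fix `k` disjoint blocks of `m = ⌊p / k⌋` coordinates each, choose one coordinate uniformly
and independently in every block, and let `v` be the unit vector that is constant on the `k` chosen
coordinates; its `ℓ_q` norm is exactly `k ^ (1 / q - 1 / 2)`. If `c` is the number of coordinates
shared by two independent choices, the inner product is `c / k`, and `(c / k)² ≤ c / k` gives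
`n ρ² ≤ t c` with `t = n θ² / k`. Since `c` is binomial with parameters `k` and `1 / m`, the second
moment is at most `(1 + (eᵗ - 1) / m) ^ k`. The condition `θ < √(k log (C p / k² + 1) / n)` says
`eᵗ - 1 < C p / k²`, and `p ≤ 2 k m`, so the second moment is at most `exp (2 C)`, which equals
`1 + δ²` for `C = log (1 + δ²) / 2`; the theorem is the case `δ = 2 ν`. The block structure makes
the overlap exactly binomial, which avoids comparing the hypergeometric law with it.
-/

open MeasureTheory ProbabilityTheory
open scoped ENNReal

namespace SparsePCA

open scoped RealInnerProductSpace

/-! ### Products of measures with densities -/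

theorem lintegral_pi_prod {ι : Type*} [Fintype ι] {X : ι → Type*} [∀ i, MeasurableSpace (X i)]
    (μ : ∀ i, Measure (X i)) [∀ i, IsProbabilityMeasure (μ i)] {f : ∀ i, X i → ℝ≥0∞}
    (hf : ∀ i, Measurable (f i)) :
    ∫⁻ x, ∏ i, f i (x i) ∂Measure.pi μ = ∏ i, ∫⁻ y, f i y ∂μ i := by
  have hind : iIndepFun (fun i (x : ∀ i, X i) => f i (x i)) (Measure.pi μ) :=
    iIndepFun_pi (X := f) fun i => (hf i).aemeasurable
  have h := lintegral_prod_eq_prod_lintegral_of_indepFun Finset.univ _ hind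
    (fun i => (hf i).comp (measurable_pi_apply i))
  rw [h]
  refine Finset.prod_congr rfl fun i _ => ?_
  rw [← (measurePreserving_eval μ i).lintegral_comp (hf i)]

theorem pi_withDensity {ι : Type*} [Fintype ι] {X : ι → Type*} [∀ i, MeasurableSpace (X i)]
    (μ : ∀ i, Measure (X i)) [∀ i, IsProbabilityMeasure (μ i)] {f : ∀ i, X i → ℝ≥0∞}
    (hf : ∀ i, Measurable (f i)) [∀ i, SigmaFinite ((μ i).withDensity (f i))] :
    Measure.pi (fun i => (μ i).withDensity (f i)) =
      (Measure.pi μ).withDensity fun x => ∏ i, f i (x i) := by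
  refine Measure.pi_eq (μ := fun i => (μ i).withDensity (f i)) fun s hs => ?_
  rw [withDensity_apply _ (MeasurableSet.univ_pi hs),
    ← lintegral_indicator (MeasurableSet.univ_pi hs)]
  have h : (Set.univ.pi s).indicator (fun x : ∀ i, X i => ∏ i, f i (x i)) =
      fun x => ∏ i, (s i).indicator (f i) (x i) := by
    ext x
    by_cases hx : x ∈ Set.univ.pi s
    · rw [Set.indicator_of_mem hx]
      exact Finset.prod_congr rfl fun i _ => (Set.indicator_of_mem (hx i trivial) _).symm
    · rw [Set.indicator_of_notMem hx]
      obtain ⟨i, hi⟩ : ∃ i, x i ∉ s i := by simpa using hx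
      exact (Finset.prod_eq_zero (Finset.mem_univ i) (Set.indicator_of_notMem hi _)).symm
  rw [h, lintegral_pi_prod μ fun i => (hf i).indicator (hs i)]
  refine Finset.prod_congr rfl fun i _ => ?_
  rw [withDensity_apply _ (hs i), lintegral_indicator (hs i)]

/-! ### Cameron–Martin formula for the standard Gaussian -/

theorem gaussianReal_eq_withDensity (a : ℝ) :
    gaussianReal a 1 =
      (gaussianReal 0 1).withDensity fun x => ENNReal.ofReal (Real.exp (a * x - a ^ 2 / 2)) := by
  rw [gaussianReal_of_var_ne_zero a one_ne_zero, gaussianReal_of_var_ne_zero 0 one_ne_zero,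
    ← withDensity_mul _ (measurable_gaussianPDF 0 1) (by fun_prop)]
  congr 1
  ext x
  rw [Pi.mul_apply, gaussianPDF, gaussianPDF, ← ENNReal.ofReal_mul (gaussianPDFReal_nonneg _ _ _),
    gaussianPDFReal, gaussianPDFReal, mul_assoc _ (Real.exp _) (Real.exp _), ← Real.exp_add]
  congr 3
  simp only [NNReal.coe_one]
  ring

section Gaussian

variable {ι : Type*} [Fintype ι]

/-- The Cameron–Martin formula: a translate of the standard Gaussian has an explicit exponential
density with respect to it. -/
theorem stdGaussian_map_add (h : EuclideanSpace ℝ ι) :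
    (stdGaussian (EuclideanSpace ℝ ι)).map (· + h) =
      (stdGaussian (EuclideanSpace ℝ ι)).withDensity
        fun x => ENNReal.ofReal (Real.exp (⟪h, x⟫ - ‖h‖ ^ 2 / 2)) := by
  have hprob : ∀ i : ι, IsProbabilityMeasure ((gaussianReal 0 1).withDensity
      fun x => ENNReal.ofReal (Real.exp (h i * x - h i ^ 2 / 2))) := fun i => by
    rw [← gaussianReal_eq_withDensity]; infer_instance
  have hdens : ∀ y : ι → ℝ,
      ENNReal.ofReal (Real.exp (⟪h, WithLp.toLp 2 y⟫ - ‖h‖ ^ 2 / 2)) =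
        ∏ i, ENNReal.ofReal (Real.exp (h i * y i - h i ^ 2 / 2)) := fun y => by
    rw [← ENNReal.ofReal_prod_of_nonneg fun i _ => (Real.exp_pos _).le, ← Real.exp_sum,
      EuclideanSpace.real_norm_sq_eq, PiLp.inner_apply, Finset.sum_sub_distrib, Finset.sum_div]
    simp [mul_comm]
  have hpi : (Measure.pi fun _ : ι => gaussianReal 0 1).map (fun y i => y i + h i) =
      (Measure.pi fun _ : ι => gaussianReal 0 1).withDensity
        fun y => ∏ i, ENNReal.ofReal (Real.exp (h i * y i - h i ^ 2 / 2)) := by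
    rw [← pi_withDensity (fun _ : ι => gaussianReal 0 1)
      (f := fun i x => ENNReal.ofReal (Real.exp (h i * x - h i ^ 2 / 2))) (fun i => by fun_prop),
      Measure.pi_map_pi (μ := fun _ : ι => gaussianReal 0 1) (f := fun i x => x + h i)
        (fun i => by fun_prop)]
    congr 1
    ext1 i
    rw [gaussianReal_map_add_const, zero_add, gaussianReal_eq_withDensity]
  refine Measure.ext fun s hs => ?_
  have hlp : Measurable (WithLp.toLp 2 : (ι → ℝ) → EuclideanSpace ℝ ι) := by fun_prop
  rw [← map_pi_eq_stdGaussian, Measure.map_map (by fun_prop) hlp, withDensity_apply _ hs,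
    setLIntegral_map hs (by fun_prop) hlp]
  simp_rw [hdens]
  rw [← withDensity_apply _ (hlp hs), ← hpi, Measure.map_apply (by fun_prop) hs,
    Measure.map_apply (by fun_prop) (hlp hs)]
  rfl

theorem lintegral_add_stdGaussian (h : EuclideanSpace ℝ ι) {g : EuclideanSpace ℝ ι → ℝ≥0∞}
    (hg : Measurable g) :
    ∫⁻ x, g (x + h) ∂stdGaussian (EuclideanSpace ℝ ι) =
      ∫⁻ x, ENNReal.ofReal (Real.exp (⟪h, x⟫ - ‖h‖ ^ 2 / 2)) * g x
        ∂stdGaussian (EuclideanSpace ℝ ι) := by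
  rw [← lintegral_map (f := g) hg (by fun_prop), stdGaussian_map_add,
    lintegral_withDensity_eq_lintegral_mul _ (by fun_prop) hg]
  rfl

theorem lintegral_exp_stdGaussian (h : EuclideanSpace ℝ ι) :
    ∫⁻ x, ENNReal.ofReal (Real.exp (⟪h, x⟫ - ‖h‖ ^ 2 / 2)) ∂stdGaussian (EuclideanSpace ℝ ι)
      = 1 := by
  simpa using (lintegral_add_stdGaussian h (g := fun _ => 1) measurable_const).symm

theorem lintegral_exp_mul_exp_stdGaussian (h h' : EuclideanSpace ℝ ι) :
    ∫⁻ x, ENNReal.ofReal (Real.exp (⟪h, x⟫ - ‖h‖ ^ 2 / 2)) *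
        ENNReal.ofReal (Real.exp (⟪h', x⟫ - ‖h'‖ ^ 2 / 2)) ∂stdGaussian (EuclideanSpace ℝ ι)
      = ENNReal.ofReal (Real.exp ⟪h, h'⟫) := by
  rw [← lintegral_add_stdGaussian h
    (g := fun x => ENNReal.ofReal (Real.exp (⟪h', x⟫ - ‖h'‖ ^ 2 / 2))) (by fun_prop)]
  have : ∀ x, ENNReal.ofReal (Real.exp (⟪h', x + h⟫ - ‖h'‖ ^ 2 / 2)) =
      ENNReal.ofReal (Real.exp ⟪h, h'⟫) *
        ENNReal.ofReal (Real.exp (⟪h', x⟫ - ‖h'‖ ^ 2 / 2)) := fun x => by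
    rw [← ENNReal.ofReal_mul (Real.exp_pos _).le, ← Real.exp_add, inner_add_right,
      real_inner_comm h' h]
    congr 2; ring
  simp_rw [this]
  rw [lintegral_const_mul _ (by fun_prop), lintegral_exp_stdGaussian, mul_one]

/-! ### Likelihood ratio of the spiked model -/

theorem posSemidef_one_add_smul_vecMulVec [DecidableEq ι] {θ : ℝ} (hθ : 0 ≤ θ) (v : ι → ℝ) :
    (1 + θ • Matrix.vecMulVec v v).PosSemidef := by
  refine Matrix.PosSemidef.one.add (Matrix.PosSemidef.smul ?_ hθ)
  simpa using Matrix.posSemidef_vecMulVec_self_star v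

/-- The spiked Gaussian is the law of `x + √θ z v` with `x` and `z` independent and standard
Gaussian: both sides have the same characteristic function. -/
theorem multivariateGaussian_eq_map_prod [DecidableEq ι] {θ : ℝ} (hθ : 0 ≤ θ)
    (v : EuclideanSpace ℝ ι) :
    multivariateGaussian 0 (1 + θ • Matrix.vecMulVec v v) =
      ((stdGaussian (EuclideanSpace ℝ ι)).prod (gaussianReal 0 1)).map
        fun y => y.1 + (√θ * y.2) • v := by
  have : IsProbabilityMeasure ((gaussianReal 0 1).map fun z : ℝ => (√θ * z) • v) :=
    Measure.isProbabilityMeasure_map (by fun_prop)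
  have hconv : ((stdGaussian (EuclideanSpace ℝ ι)).prod (gaussianReal 0 1)).map
        (fun y => y.1 + (√θ * y.2) • v) =
      (stdGaussian (EuclideanSpace ℝ ι)).conv
        ((gaussianReal 0 1).map fun z : ℝ => (√θ * z) • v) := by
    rw [Measure.conv, ← Measure.map_id (μ := stdGaussian (EuclideanSpace ℝ ι)),
      Measure.map_prod_map _ _ measurable_id (by fun_prop), Measure.map_map (by fun_prop)
      (by fun_prop), Measure.map_id]
    rfl
  rw [hconv]
  refine Measure.ext_of_charFun (funext fun t => ?_)
  have hline : charFun ((gaussianReal 0 1).map fun z : ℝ => (√θ * z) • v) t =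
      charFun (gaussianReal 0 1) (√θ * ⟪v, t⟫) := by
    rw [charFun_apply, charFun_apply, integral_map (by fun_prop) (by fun_prop)]
    congr 1
    ext z
    simp only [real_inner_smul_left, RCLike.inner_apply, conj_trivial]
    congr 3; ring
  rw [charFun_conv, charFun_stdGaussian, hline, charFun_gaussianReal,
    charFun_multivariateGaussian (posSemidef_one_add_smul_vecMulVec hθ _), ← Complex.exp_add]
  congr 1
  have h1 : (t.ofLp ⬝ᵥ (1 + θ • Matrix.vecMulVec v.ofLp v.ofLp).mulVec t.ofLp) =
      ‖t‖ ^ 2 + (√θ * ⟪v, t⟫) ^ 2 := by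
    rw [Matrix.add_mulVec, Matrix.one_mulVec, Matrix.smul_mulVec, Matrix.vecMulVec_mulVec,
      dotProduct_add, mul_pow, Real.sq_sqrt hθ, EuclideanSpace.real_norm_sq_eq]
    simp only [dotProduct, PiLp.inner_apply, RCLike.inner_apply, conj_trivial]
    simp [Finset.mul_sum, Finset.sum_mul, sq]
    exact Finset.sum_congr rfl fun i _ => Finset.sum_congr rfl fun j _ => by ring
  rw [h1]
  push_cast
  simp
  ring

/-- The likelihood ratio of `N(0, I + θ v vᵀ)` with respect to `N(0, I)`, written as the average
over a standard normal `z` of the likelihood ratio of the shift `√θ z v`. -/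
noncomputable def spikedDensity (θ : ℝ) (v x : EuclideanSpace ℝ ι) : ℝ≥0∞ :=
  ∫⁻ z, ENNReal.ofReal (Real.exp (⟪(√θ * z) • v, x⟫ - ‖(√θ * z) • v‖ ^ 2 / 2))
    ∂gaussianReal 0 1

theorem measurable_spikedDensity (θ : ℝ) (v : EuclideanSpace ℝ ι) :
    Measurable (spikedDensity θ v) :=
  Measurable.lintegral_prod_right' (f := fun y : EuclideanSpace ℝ ι × ℝ =>
    ENNReal.ofReal (Real.exp (⟪(√θ * y.2) • v, y.1⟫ - ‖(√θ * y.2) • v‖ ^ 2 / 2)))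
    (by fun_prop)

theorem multivariateGaussian_eq_withDensity [DecidableEq ι] {θ : ℝ} (hθ : 0 ≤ θ)
    (v : EuclideanSpace ℝ ι) :
    multivariateGaussian 0 (1 + θ • Matrix.vecMulVec v v) =
      (stdGaussian (EuclideanSpace ℝ ι)).withDensity (spikedDensity θ v) := by
  refine Measure.ext_of_lintegral _ fun g hg => ?_
  rw [multivariateGaussian_eq_map_prod hθ, lintegral_map hg (by fun_prop),
    lintegral_prod_symm' _ (by fun_prop),
    lintegral_withDensity_eq_lintegral_mul _ (measurable_spikedDensity θ v) hg]
  simp_rw [lintegral_add_stdGaussian _ hg]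
  rw [lintegral_lintegral_swap (by fun_prop)]
  refine lintegral_congr fun x => ?_
  rw [lintegral_mul_const _ (by fun_prop)]
  rfl

/-! ### Second moment of the likelihood ratio -/

theorem lintegral_exp_mul_gaussianReal (a : ℝ) :
    ∫⁻ z, ENNReal.ofReal (Real.exp (a * z)) ∂gaussianReal 0 1 =
      ENNReal.ofReal (Real.exp (a ^ 2 / 2)) := by
  rw [← ofReal_integral_eq_lintegral_ofReal (integrable_exp_mul_gaussianReal a)
    (ae_of_all _ fun _ => (Real.exp_pos _).le)]
  have := mgf_gaussianReal (μ := 0) (v := 1) (p := gaussianReal 0 1) (X := id) (by simp) a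
  rw [mgf] at this
  simp only [id] at this
  rw [this]; simp

theorem lintegral_exp_mul_sq_gaussianReal {r : ℝ} (hr : r < 1) :
    ∫⁻ z, ENNReal.ofReal (Real.exp (r * z ^ 2 / 2)) ∂gaussianReal 0 1 =
      ENNReal.ofReal (√(1 - r))⁻¹ := by
  have h1 : (0 : ℝ) < 1 - r := by linarith
  have hv : ((1 - r)⁻¹).toNNReal ≠ 0 := by simpa using hr
  -- The integrand is `(1 - r)^{-1/2}` times the density of the normal law of variance `(1 - r)⁻¹`.
  rw [gaussianReal_of_var_ne_zero 0 one_ne_zero,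
    lintegral_withDensity_eq_lintegral_mul _ (measurable_gaussianPDF 0 1) (by fun_prop),
    ← mul_one (ENNReal.ofReal _), ← lintegral_gaussianPDF_eq_one 0 hv,
    ← lintegral_const_mul _ (measurable_gaussianPDF _ _)]
  refine lintegral_congr fun z => ?_
  rw [Pi.mul_apply, gaussianPDF, gaussianPDF, ← ENNReal.ofReal_mul (gaussianPDFReal_nonneg _ _ _),
    ← ENNReal.ofReal_mul (by positivity), gaussianPDFReal, gaussianPDFReal,
    Real.coe_toNNReal _ (by positivity), mul_assoc, ← Real.exp_add, ← mul_assoc, ← mul_inv,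
    ← Real.sqrt_mul h1.le]
  congr 3
  · congr 1
    field_simp
    simp
  · simp only [NNReal.coe_one]
    field_simp
    ring

theorem lintegral_spikedDensity_mul {θ : ℝ} (hθ : 0 ≤ θ) {u v : EuclideanSpace ℝ ι}
    (huv : (θ * ⟪u, v⟫) ^ 2 < 1) :
    ∫⁻ x, spikedDensity θ u x * spikedDensity θ v x ∂stdGaussian (EuclideanSpace ℝ ι) =
      ENNReal.ofReal (√(1 - (θ * ⟪u, v⟫) ^ 2))⁻¹ := by
  have hprod : ∀ x, spikedDensity θ u x * spikedDensity θ v x =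
      ∫⁻ z, ∫⁻ z', ENNReal.ofReal (Real.exp (⟪(√θ * z) • u, x⟫ - ‖(√θ * z) • u‖ ^ 2 / 2)) *
        ENNReal.ofReal (Real.exp (⟪(√θ * z') • v, x⟫ - ‖(√θ * z') • v‖ ^ 2 / 2))
        ∂gaussianReal 0 1 ∂gaussianReal 0 1 := fun x => by
    rw [lintegral_lintegral_mul (by fun_prop) (by fun_prop)]
    rfl
  simp_rw [hprod]
  rw [lintegral_lintegral_swap]
  swap
  · exact (Measurable.lintegral_prod_right' (f := fun y : (EuclideanSpace ℝ ι × ℝ) × ℝ =>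
      ENNReal.ofReal (Real.exp (⟪(√θ * y.1.2) • u, y.1.1⟫ - ‖(√θ * y.1.2) • u‖ ^ 2 / 2)) *
        ENNReal.ofReal (Real.exp (⟪(√θ * y.2) • v, y.1.1⟫ - ‖(√θ * y.2) • v‖ ^ 2 / 2)))
      (by fun_prop)).aemeasurable
  rw [← lintegral_exp_mul_sq_gaussianReal huv]
  refine lintegral_congr fun z => ?_
  rw [lintegral_lintegral_swap (by fun_prop)]
  simp_rw [lintegral_exp_mul_exp_stdGaussian]
  have : ∀ z', ⟪(√θ * z) • u, (√θ * z') • v⟫ = (θ * ⟪u, v⟫ * z) * z' := fun z' => by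
    rw [real_inner_smul_left, real_inner_smul_right]
    linear_combination (z * z' * ⟪u, v⟫) * Real.mul_self_sqrt hθ
  simp_rw [this]
  rw [lintegral_exp_mul_gaussianReal]
  congr 2; ring

end Gaussian

theorem inv_sqrt_one_sub_le_exp {x : ℝ} (h0 : 0 ≤ x) (h1 : x ≤ 1 / 2) :
    (√(1 - x))⁻¹ ≤ Real.exp x := by
  -- The claim is `1 ≤ (1 - x) * exp (2 * x)`, and `(1 - x) * (1 + 2 * x) ≥ 1` on `[0, 1/2]`.
  have h := Real.add_one_le_exp (2 * x)
  have h2 : 1 ≤ √(1 - x) * Real.exp x := by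
    rw [← Real.sqrt_sq (Real.exp_pos x).le, ← Real.sqrt_mul (by linarith), Real.one_le_sqrt,
      ← Real.exp_nat_mul]
    push_cast
    nlinarith
  rwa [inv_le_iff_one_le_mul₀' (Real.sqrt_pos.2 (by linarith))]

/-! ### Lower bound on the testing error by the second moment -/

/-- If a probability density `L` has second moment at most `1 + δ²`, passing from `μ` to the measure
with density `L` increases the probability of an event by at most `δ`. -/
theorem setLIntegral_le_measure_add {Ω : Type*} [MeasurableSpace Ω] {μ : Measure Ω}
    [IsProbabilityMeasure μ] {L : Ω → ℝ≥0∞} (hL : Measurable L) (h1 : ∫⁻ x, L x ∂μ = 1)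
    {δ : ℝ} (hδ : 0 < δ) (h2 : ∫⁻ x, L x ^ 2 ∂μ ≤ ENNReal.ofReal (1 + δ ^ 2))
    {A : Set Ω} (hA : MeasurableSet A) :
    ∫⁻ x in A, L x ∂μ ≤ μ A + ENNReal.ofReal δ := by
  set d := ENNReal.ofReal δ with hd
  -- The inequality `(L - 1 - δ 1_A)² ≥ 0`, expanded and with all terms nonnegative; its integral
  -- replaces the Cauchy–Schwarz inequality and avoids subtraction in `ℝ≥0∞`.
  have hpt : ∀ x, 2 * L x + 2 * d * A.indicator L x ≤
      L x ^ 2 + 1 + (2 * d + d ^ 2) * A.indicator 1 x := fun x => by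
    rcases eq_or_ne (L x) ∞ with hx | hx
    · simp [hx]
    · lift L x to NNReal using hx with l hl
      have hd' : d = ((δ.toNNReal : NNReal) : ℝ≥0∞) := rfl
      by_cases hxA : x ∈ A
      · simp only [Set.indicator_of_mem hxA, ← hl, hd', Pi.one_apply]
        norm_cast
        rw [← NNReal.coe_le_coe]
        push_cast
        nlinarith [sq_nonneg ((l : ℝ) - 1 - δ.toNNReal)]
      · simp only [Set.indicator_of_notMem hxA, mul_zero, add_zero]
        norm_cast
        rw [← NNReal.coe_le_coe]
        push_cast
        nlinarith [sq_nonneg ((l : ℝ) - 1)]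
  have hint := lintegral_mono (μ := μ) hpt
  rw [lintegral_add_left (by fun_prop), lintegral_const_mul _ hL, h1,
    lintegral_const_mul _ (hL.indicator hA), lintegral_indicator hA,
    lintegral_add_left (by fun_prop), lintegral_add_left (by fun_prop), lintegral_const_mul _
    (measurable_one.indicator hA), lintegral_indicator_one hA] at hint
  simp only [lintegral_const, measure_univ, mul_one] at hint
  have hint2 := hint.trans (by gcongr : _ ≤ ENNReal.ofReal (1 + δ ^ 2) + 1 + (2 * d + d ^ 2) * μ A)
  have hA1 : μ A ≤ 1 := prob_le_one
  have hAt : μ A ≠ ∞ := measure_ne_top _ _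
  have hbt : ∫⁻ x in A, L x ∂μ ≠ ∞ :=
    ((setLIntegral_le_lintegral A L).trans_lt (h1 ▸ ENNReal.one_lt_top)).ne
  generalize ∫⁻ x in A, L x ∂μ = b at *
  generalize μ A = a at *
  lift a to NNReal using hAt
  lift b to NNReal using hbt
  have hd' : d = ((δ.toNNReal : NNReal) : ℝ≥0∞) := rfl
  have hδ' : (δ.toNNReal : ℝ) = δ := Real.coe_toNNReal _ hδ.le
  rw [hd', ENNReal.ofReal] at hint2
  rw [hd']
  norm_cast at hint2 hA1 ⊢
  rw [← NNReal.coe_le_coe] at hint2 hA1 ⊢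
  push_cast at hint2 hA1 ⊢
  rw [hδ', Real.coe_toNNReal _ (by positivity)] at hint2
  rw [hδ']
  have : δ * (2 * b) ≤ δ * (2 * (a + δ)) := by nlinarith
  nlinarith [le_of_mul_le_mul_left this hδ]

instance isProbabilityMeasure_nullLaw (p n : ℕ) : IsProbabilityMeasure (nullLaw p n) := by
  unfold nullLaw; infer_instance

instance isProbabilityMeasure_spikedLaw (p n : ℕ) (θ : ℝ) (v : EuclideanSpace ℝ (Fin p)) :
    IsProbabilityMeasure (spikedLaw p n θ v) := by
  unfold spikedLaw; infer_instance

/-- The likelihood ratio of `n` i.i.d. observations of the spiked model against the null model. -/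
noncomputable def sampleDensity {p : ℕ} (n : ℕ) (θ : ℝ) (v : EuclideanSpace ℝ (Fin p))
    (x : Fin n → EuclideanSpace ℝ (Fin p)) : ℝ≥0∞ :=
  ∏ i, spikedDensity θ v (x i)

theorem measurable_sampleDensity {p n : ℕ} (θ : ℝ) (v : EuclideanSpace ℝ (Fin p)) :
    Measurable (sampleDensity n θ v) :=
  Finset.measurable_fun_prod _ fun i _ =>
    (measurable_spikedDensity θ v).comp (measurable_pi_apply i)

theorem spikedLaw_eq_withDensity {p n : ℕ} {θ : ℝ} (hθ : 0 ≤ θ) (v : EuclideanSpace ℝ (Fin p)) :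
    spikedLaw p n θ v = (nullLaw p n).withDensity (sampleDensity n θ v) := by
  have hprob : IsProbabilityMeasure
      ((stdGaussian (EuclideanSpace ℝ (Fin p))).withDensity (spikedDensity θ v)) := by
    rw [← multivariateGaussian_eq_withDensity hθ]; infer_instance
  rw [spikedLaw, nullLaw, multivariateGaussian_eq_withDensity hθ, multivariateGaussian_zero_one]
  exact pi_withDensity (fun _ : Fin n => stdGaussian (EuclideanSpace ℝ (Fin p)))
    (f := fun _ => spikedDensity θ v) fun _ => measurable_spikedDensity θ v

theorem lintegral_sampleDensity_mul_le {p n : ℕ} {θ : ℝ} (hθ : 0 ≤ θ)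
    {u v : EuclideanSpace ℝ (Fin p)} (huv : (θ * ⟪u, v⟫) ^ 2 ≤ 1 / 2) :
    ∫⁻ x, sampleDensity n θ u x * sampleDensity n θ v x ∂nullLaw p n ≤
      ENNReal.ofReal (Real.exp (n * (θ * ⟪u, v⟫) ^ 2)) := by
  simp_rw [sampleDensity, ← Finset.prod_mul_distrib]
  rw [nullLaw, multivariateGaussian_zero_one,
    lintegral_pi_prod (fun _ : Fin n => stdGaussian (EuclideanSpace ℝ (Fin p)))
      (f := fun _ y => spikedDensity θ u y * spikedDensity θ v y)
      fun _ => (measurable_spikedDensity θ u).mul (measurable_spikedDensity θ v),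
    lintegral_spikedDensity_mul hθ (by linarith), Finset.prod_const, Finset.card_univ,
    Fintype.card_fin, Real.exp_nat_mul, ENNReal.ofReal_pow (Real.exp_pos _).le]
  gcongr
  exact inv_sqrt_one_sub_le_exp (sq_nonneg _) huv

/-- Lower bound on the minimax error by the second moment method, for the uniform prior on a finite
family `v` of spike directions; repetitions in the family are allowed. -/
theorem le_minimaxError_of_secondMoment {p n : ℕ} {θ : ℝ} (hθ : 0 ≤ θ)
    {V : Set (EuclideanSpace ℝ (Fin p))} {ι : Type*} [Fintype ι] [Nonempty ι]
    (v : ι → EuclideanSpace ℝ (Fin p)) (hv : ∀ a, v a ∈ V) {δ : ℝ} (hδ : 0 < δ)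
    (hsecond : ∑ a, ∑ b, ∫⁻ x, sampleDensity n θ (v a) x * sampleDensity n θ (v b) x ∂nullLaw p n
      ≤ (Fintype.card ι : ℝ≥0∞) ^ 2 * ENNReal.ofReal (1 + δ ^ 2)) :
    ENNReal.ofReal ((1 - δ) / 2) ≤ minimaxError p n θ V := by
  set N : ℝ≥0∞ := (Fintype.card ι : ℝ≥0∞) with hN
  have hN0 : N ≠ 0 := by simp [hN]
  have hNt : N ≠ ∞ := ENNReal.natCast_ne_top _
  have hmeas := fun a => measurable_sampleDensity (n := n) θ (v a)
  set L : (Fin n → EuclideanSpace ℝ (Fin p)) → ℝ≥0∞ :=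
    fun x => N⁻¹ * ∑ a, sampleDensity n θ (v a) x with hLdef
  have hLm : Measurable L := (Finset.measurable_fun_sum _ fun a _ => hmeas a).const_mul _
  have hset : ∀ B, MeasurableSet B →
      ∫⁻ x in B, L x ∂nullLaw p n = N⁻¹ * ∑ a, spikedLaw p n θ (v a) B := fun B hB => by
    rw [hLdef, lintegral_const_mul _ (Finset.measurable_fun_sum _ fun a _ => hmeas a),
      lintegral_finsetSum _ fun a _ => hmeas a]
    congr 1
    refine Finset.sum_congr rfl fun a _ => ?_
    rw [spikedLaw_eq_withDensity hθ, withDensity_apply _ hB]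
  have hL1 : ∫⁻ x, L x ∂nullLaw p n = 1 := by
    rw [← setLIntegral_univ, hset _ MeasurableSet.univ]
    simp [← hN, ENNReal.inv_mul_cancel hN0 hNt]
  have hL2 : ∫⁻ x, L x ^ 2 ∂nullLaw p n ≤ ENNReal.ofReal (1 + δ ^ 2) := by
    have hsq : ∀ x, L x ^ 2 = (N⁻¹) ^ 2 *
        ∑ a, ∑ b, sampleDensity n θ (v a) x * sampleDensity n θ (v b) x := fun x => by
      rw [hLdef, mul_pow, sq (∑ a, _), Finset.sum_mul_sum]
    have hab : ∀ a b, Measurable fun x =>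
        sampleDensity n θ (v a) x * sampleDensity n θ (v b) x :=
      fun a b => (hmeas a).mul (hmeas b)
    simp_rw [hsq]
    rw [lintegral_const_mul _ (Finset.measurable_fun_sum _ fun a _ =>
        Finset.measurable_fun_sum _ fun b _ => hab a b),
      lintegral_finsetSum _ fun a _ => Finset.measurable_fun_sum _ fun b _ => hab a b,
      Finset.sum_congr rfl fun a _ => lintegral_finsetSum _ fun b _ => hab a b]
    calc _ ≤ (N⁻¹) ^ 2 * (N ^ 2 * ENNReal.ofReal (1 + δ ^ 2)) := by gcongr
      _ = _ := by rw [← mul_assoc, ← mul_pow, ENNReal.inv_mul_cancel hN0 hNt, one_pow, one_mul]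
  refine le_iInf fun ψ => ?_
  have hA : MeasurableSet {x | ψ.1 x = 1} := ψ.2 (measurableSet_singleton _)
  have hB : MeasurableSet {x | ψ.1 x = 0} := ψ.2 (measurableSet_singleton _)
  have hcompl : {x | ψ.1 x = 0} = {x | ψ.1 x = 1}ᶜ := by
    ext x
    simp only [Set.mem_ofPred_eq, Set.mem_compl_iff]
    generalize ψ.1 x = y
    fin_cases y <;> simp
  have htest := setLIntegral_le_measure_add hLm hL1 hδ hL2 hA
  have hsum : ∫⁻ x in {x | ψ.1 x = 1}, L x ∂nullLaw p n +
      ∫⁻ x in {x | ψ.1 x = 0}, L x ∂nullLaw p n = 1 := by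
    rw [hcompl, lintegral_add_compl _ hA, hL1]
  set e := worstCaseError θ V ψ with he
  have he0 : nullLaw p n {x | ψ.1 x = 1} ≤ e := le_max_left _ _
  have he1 : ∫⁻ x in {x | ψ.1 x = 0}, L x ∂nullLaw p n ≤ e := by
    rw [hset _ hB]
    calc _ ≤ N⁻¹ * ∑ _a : ι, e := by
          gcongr with a
          exact (le_iSup₂ (f := fun u (_ : u ∈ V) => spikedLaw p n θ u {x | ψ.1 x = 0})
            (v a) (hv a)).trans (le_max_right _ _)
      _ = e := by
          rw [Finset.sum_const, Finset.card_univ, nsmul_eq_mul, ← mul_assoc,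
            ENNReal.inv_mul_cancel hN0 hNt, one_mul]
  have hfin : 1 ≤ 2 * e + ENNReal.ofReal δ := by
    rw [← hsum, two_mul, add_right_comm]
    gcongr
    exact htest.trans (by gcongr)
  have h2 : ENNReal.ofReal (1 - δ) ≤ 2 * e := by
    rw [ENNReal.ofReal_sub _ hδ.le, ENNReal.ofReal_one]
    exact tsub_le_iff_right.2 hfin
  rw [ENNReal.ofReal_div_of_pos two_pos, ENNReal.ofReal_ofNat]
  exact ENNReal.div_le_of_le_mul (by rwa [mul_comm])

/-! ### Flat vectors supported on one coordinate per block -/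

/-- The vector that is constant on `S`, zero outside `S`, and of Euclidean norm one if `S` is
nonempty. -/
noncomputable def flatVector {p : ℕ} (S : Finset (Fin p)) : EuclideanSpace ℝ (Fin p) :=
  WithLp.toLp 2 fun j => if j ∈ S then (√(S.card : ℝ))⁻¹ else 0

theorem inner_flatVector {p k : ℕ} {S T : Finset (Fin p)} (hS : S.card = k) (hT : T.card = k) :
    ⟪flatVector S, flatVector T⟫ = ((S ∩ T).card : ℝ) / k := by
  have : ∀ j, (if j ∈ T then (√(k : ℝ))⁻¹ else 0) * (if j ∈ S then (√(k : ℝ))⁻¹ else 0) =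
      if j ∈ S ∩ T then (k : ℝ)⁻¹ else 0 := fun j => by
    by_cases h1 : j ∈ S <;> by_cases h2 : j ∈ T <;> simp [h1, h2, ← mul_inv]
  simp [PiLp.inner_apply, flatVector, hS, hT, this, div_eq_mul_inv, -Finset.mem_inter]

theorem flatVector_mem_unitLqBall {p k : ℕ} (hk : 1 ≤ k) {S : Finset (Fin p)} (hS : S.card = k)
    {q : ℝ} (hq : 0 < q) : flatVector S ∈ unitLqBall p q ((k : ℝ) ^ (1 / q - 1 / 2)) := by
  have hk0 : (0 : ℝ) < k := by exact_mod_cast hk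
  constructor
  · rw [← sq_eq_sq₀ (norm_nonneg _) zero_le_one, ← real_inner_self_eq_norm_sq,
      inner_flatVector hS hS, Finset.inter_self, hS, div_self hk0.ne', one_pow]
  · have : ∀ j, |flatVector S j| ^ q = if j ∈ S then (k : ℝ) ^ (-(q / 2)) else 0 := fun j => by
      by_cases hj : j ∈ S
      · simp only [flatVector, hj, if_true, hS]
        rw [abs_of_nonneg (by positivity), Real.sqrt_eq_rpow, ← Real.rpow_neg hk0.le,
          ← Real.rpow_mul hk0.le]
        congr 1; ring
      · simp [flatVector, hj, Real.zero_rpow hq.ne']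
    rw [lqNorm]
    simp_rw [this]
    rw [← Finset.sum_filter, Finset.sum_const, Finset.filter_mem_eq_inter, Finset.univ_inter, hS,
      nsmul_eq_mul, show (k : ℝ) * (k : ℝ) ^ (-(q / 2)) = (k : ℝ) ^ (1 - q / 2) by
        rw [sub_eq_add_neg, Real.rpow_add hk0, Real.rpow_one], ← Real.rpow_mul hk0.le]
    refine le_of_eq (congrArg _ ?_)
    field_simp

/-- The support that selects, in the `i`-th block of coordinates, the coordinate numbered `f i`.
The embedding `e` sends `(i, j)` to the `j`-th coordinate of the `i`-th block. -/
def blockSupport {p k m : ℕ} (e : Fin k × Fin m ↪ Fin p) (f : Fin k → Fin m) : Finset (Fin p) :=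
  Finset.univ.image fun i => e (i, f i)

theorem card_blockSupport {p k m : ℕ} (e : Fin k × Fin m ↪ Fin p) (f : Fin k → Fin m) :
    (blockSupport e f).card = k := by
  rw [blockSupport, Finset.card_image_of_injective, Finset.card_fin]
  intro i j h
  exact congrArg Prod.fst (e.injective h)

theorem card_blockSupport_inter {p k m : ℕ} (e : Fin k × Fin m ↪ Fin p) (f g : Fin k → Fin m) :
    (blockSupport e f ∩ blockSupport e g).card = (Finset.univ.filter fun i => f i = g i).card := by
  rw [← Finset.card_image_of_injective (f := fun i => e (i, f i)) (Finset.univ.filter _)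
    fun i j h => congrArg Prod.fst (e.injective h)]
  congr 1
  ext j
  simp only [blockSupport, Finset.mem_inter, Finset.mem_image, Finset.mem_univ, true_and,
    Finset.mem_filter]
  constructor
  · rintro ⟨⟨i, rfl⟩, i', hi'⟩
    have h := e.injective hi'
    obtain rfl : i' = i := congrArg Prod.fst h
    exact ⟨i', (congrArg Prod.snd h).symm, rfl⟩
  · rintro ⟨i, hi, rfl⟩
    exact ⟨⟨i, rfl⟩, i, by rw [hi]⟩

/-- The moment generating function, up to the factor `m ^ k`, of the number of agreements of `f` with
a uniformly random `g`, which is binomial with parameters `k` and `1 / m`. -/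
theorem sum_exp_card_agree {k m : ℕ} (f : Fin k → Fin m) (t : ℝ) :
    ∑ g : Fin k → Fin m, Real.exp (t * (Finset.univ.filter fun i => f i = g i).card) =
      (m + (Real.exp t - 1)) ^ k := by
  have h : ∀ g : Fin k → Fin m, Real.exp (t * (Finset.univ.filter fun i => f i = g i).card) =
      ∏ i, if f i = g i then Real.exp t else 1 := fun g => by
    rw [mul_comm, Real.exp_nat_mul, ← Finset.prod_filter, Finset.prod_const]
  simp_rw [h]
  rw [← Fintype.prod_sum fun i j => if f i = j then Real.exp t else 1]
  have hrow : ∀ i, ∑ j, (if f i = j then Real.exp t else 1) = m + (Real.exp t - 1) := fun i => by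
    have : ∀ j, (if f i = j then Real.exp t else 1) = 1 + if f i = j then Real.exp t - 1 else 0 :=
      fun j => by split_ifs <;> ring
    simp_rw [this, Finset.sum_add_distrib]
    simp
  simp [hrow]

theorem add_pow_le_of_block {C : ℝ} (hC : 0 < C) {p k m : ℕ} (hk : 1 ≤ k) (hm : 1 ≤ m)
    (hp : p ≤ 2 * (k * m)) {t : ℝ} (ht : t ≤ Real.log (C * p / (k : ℝ) ^ 2 + 1)) :
    (m + (Real.exp t - 1)) ^ k ≤ (m : ℝ) ^ k * Real.exp (2 * C) := by
  have hk0 : (0 : ℝ) < k := by exact_mod_cast hk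
  have hm0 : (1 : ℝ) ≤ m := by exact_mod_cast hm
  have hp' : (p : ℝ) ≤ 2 * (k * m) := by exact_mod_cast hp
  have hexp : Real.exp t - 1 ≤ m * (2 * C / k) := by
    have h1 : Real.exp t ≤ C * p / (k : ℝ) ^ 2 + 1 := (Real.le_log_iff_exp_le (by positivity)).1 ht
    have h2 : C * p / (k : ℝ) ^ 2 ≤ m * (2 * C / k) := by
      rw [div_le_iff₀ (by positivity)]
      calc C * p ≤ C * (2 * (k * m)) := by gcongr
        _ = _ := by field_simp
    linarith
  calc (m + (Real.exp t - 1)) ^ k ≤ (m * Real.exp (2 * C / k)) ^ k := by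
        refine pow_le_pow_left₀ (by linarith [Real.exp_pos t]) ?_ k
        nlinarith [Real.add_one_le_exp (2 * C / k)]
    _ = _ := by
        rw [mul_pow, ← Real.exp_nat_mul]
        congr 2; field_simp

/-! ### Minimax lower bound -/

theorem le_minimaxError_of_lt_detectionLevel {δ : ℝ} (hδ : 0 < δ) {p n k : ℕ} (hn : 1 ≤ n)
    (hk : 1 ≤ k) (hkp : k ≤ p) {θ : ℝ} (hθ : 0 < θ)
    (hlt : θ < detectionLevel (Real.log (1 + δ ^ 2) / 2) p n k) {q : ℝ} (hq : 0 < q) :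
    ENNReal.ofReal ((1 - δ) / 2) ≤
      minimaxError p n θ (unitLqBall p q ((k : ℝ) ^ (1 / q - 1 / 2))) := by
  set C := Real.log (1 + δ ^ 2) / 2 with hCdef
  have hC : 0 < C := half_pos (Real.log_pos (by nlinarith))
  have hk0 : (0 : ℝ) < k := by exact_mod_cast hk
  have hn0 : (0 : ℝ) < n := by exact_mod_cast hn
  obtain ⟨hlt1, hlt2⟩ := lt_min_iff.1 hlt
  have hθsq : θ ^ 2 ≤ 1 / 2 := by
    have h : θ < √(1 / 2) := by rwa [Real.sqrt_div zero_le_one, Real.sqrt_one]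
    exact ((Real.lt_sqrt hθ.le).1 h).le
  have ht : n * θ ^ 2 / k ≤ Real.log (C * p / (k : ℝ) ^ 2 + 1) := by
    have h := (Real.lt_sqrt hθ.le).1 hlt1
    rw [lt_div_iff₀ hn0] at h
    rw [div_le_iff₀ hk0]
    linarith
  have hm : 1 ≤ p / k := Nat.div_pos hkp hk
  have hpm : p ≤ 2 * (k * (p / k)) := by
    have h1 := Nat.div_add_mod p k
    have h2 := Nat.mod_lt p hk
    have h3 : k ≤ k * (p / k) := Nat.le_mul_of_pos_right k hm
    omega
  set m := p / k with hmdef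
  have : NeZero m := ⟨by omega⟩
  let e : Fin k × Fin m ↪ Fin p :=
    finProdFinEquiv.toEmbedding.trans (Fin.castLEEmb (Nat.mul_div_le p k))
  refine le_minimaxError_of_secondMoment hθ.le
    (fun f : Fin k → Fin m => flatVector (blockSupport e f))
    (fun f => flatVector_mem_unitLqBall hk (card_blockSupport e f) hq) hδ ?_
  have hpair : ∀ f g : Fin k → Fin m,
      ∫⁻ x, sampleDensity n θ (flatVector (blockSupport e f)) x *
          sampleDensity n θ (flatVector (blockSupport e g)) x ∂nullLaw p n ≤
        ENNReal.ofReal (Real.exp (n * θ ^ 2 / k *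
          (Finset.univ.filter fun i => f i = g i).card)) := fun f g => by
    have hin := inner_flatVector (card_blockSupport e f) (card_blockSupport e g)
    rw [card_blockSupport_inter] at hin
    set c := (Finset.univ.filter fun i => f i = g i).card
    have hck : (c : ℝ) ≤ k := by
      exact_mod_cast (Finset.card_filter_le _ _).trans (Finset.card_fin k).le
    have hsq : ((c : ℝ) / k) ^ 2 ≤ c / k := by
      have h1 : (c : ℝ) / k ≤ 1 := div_le_one_of_le₀ hck hk0.le
      have h0 : (0 : ℝ) ≤ c / k := by positivity
      nlinarith
    have h1 : (c : ℝ) / k ≤ 1 := div_le_one_of_le₀ hck hk0.le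
    refine (lintegral_sampleDensity_mul_le hθ.le ?_).trans ?_
    · rw [hin, mul_pow]
      nlinarith [sq_nonneg θ]
    · rw [hin, mul_pow]
      refine ENNReal.ofReal_le_ofReal (Real.exp_le_exp.2 ?_)
      calc n * (θ ^ 2 * ((c : ℝ) / k) ^ 2) ≤ n * (θ ^ 2 * (c / k)) := by gcongr
        _ = _ := by ring
  calc _ ≤ ∑ f : Fin k → Fin m, ∑ g : Fin k → Fin m, ENNReal.ofReal (Real.exp (n * θ ^ 2 / k *
          (Finset.univ.filter fun i => f i = g i).card)) := by
        gcongr with f _ g _; exact hpair f g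
    _ = ∑ _f : Fin k → Fin m, ENNReal.ofReal ((m + (Real.exp (n * θ ^ 2 / k) - 1)) ^ k) := by
        refine Finset.sum_congr rfl fun f _ => ?_
        rw [← ENNReal.ofReal_sum_of_nonneg fun g _ => (Real.exp_pos _).le, sum_exp_card_agree]
    _ ≤ ∑ _f : Fin k → Fin m, ENNReal.ofReal ((m : ℝ) ^ k * Real.exp (2 * C)) := by
        gcongr
        exact add_pow_le_of_block hC hk hm hpm ht
    _ = _ := by
        rw [hCdef, mul_div_cancel₀ _ two_ne_zero, Real.exp_log (by positivity), Finset.sum_const,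
          ENNReal.ofReal_mul (by positivity), Finset.card_univ, Fintype.card_fun, Fintype.card_fin,
          Fintype.card_fin, ENNReal.ofReal_pow (by positivity), ENNReal.ofReal_natCast,
          nsmul_eq_mul]
        push_cast
        ring

end SparsePCA

theorem mainTheorem5 (ν : ℝ) (hν : 0 < ν) :
    ∃ C : ℝ, 0 < C ∧
      ∀ (p n k : ℕ), 1 ≤ n → 1 ≤ k → k ≤ p →
      ∀ θ : ℝ, 0 < θ → θ < SparsePCA.detectionLevel C p n k →
      ∀ q : ℝ, 0 < q → q < 2 →
        ENNReal.ofReal (1 / 2 - ν) ≤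
          SparsePCA.minimaxError p n θ
            (SparsePCA.unitLqBall p q ((k : ℝ) ^ (1 / q - 1 / 2))) := by
  refine ⟨Real.log (1 + (2 * ν) ^ 2) / 2, half_pos (Real.log_pos (by nlinarith)), ?_⟩
  intro p n k hn hk hkp θ hθ hlt q hq _
  convert SparsePCA.le_minimaxError_of_lt_detectionLevel (by positivity : 0 < 2 * ν)
    hn hk hkp hθ hlt hq using 2
  ring
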